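/- Let $d\ge 2$ be an integer, $0<\delta\le 2/3$, and let $T$ be an integer with $T\ge \frac{16(d-1)^2}{2025\,\delta}$. Put $$\Delta=\frac{d-1}{45\sqrt{(2T\log 2)/(5\delta)}},\qquad \alpha=\sqrt{\frac{\Delta}{(d-1)(1+\Delta)}},\qquad \beta=\sqrt{\frac1{1+\Delta}} .$$ For $\theta\in\Theta:=\{-\Delta/(d-1),\,\Delta/(d-1)\}^{d-1}$ let $M_\theta$ be the MDP with states $x_0,x_1$, actions $a\in\{-1,1\}^{d-1}$, rewards $r(x_0,a)=0$, $r(x_1,a)=1$, and transition probabilities $P(x_1\mid x_0,a)=\delta+\langle a,\theta\rangle$, $P(x_0\mid x_0,a)=1-\delta-\langle a,\theta\rangle$, $P(x_0\mid x_1,a)=\delta$, $P(x_1\mid x_1,a)=1-\delta$. Let $\bar\theta=(\theta/\alpha,1/\beta)\in\mathbb R^d$ and $$\phi(x_0,a,x_0)=(-\alpha a,\beta(1-\delta)),\quad \phi(x_0,a,x_1)=(\alpha a,\beta\delta),\quad \phi(x_1,a,x_0)=(0,\beta\delta),\quad \phi(x_1,a,x_1)=(0,\beta(1-\delta)),$$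 and $\phi_F(s,a)=\sum_{s'}F(s')\phi(s,a,s')$ for $F:\{x_0,x_1\}\to\mathbb R$. Then the following hold. 1. For every $\theta\in\Theta$, $M_\theta$ is an MDP with rewards in $[0,1]$, and it is a linear mixture MDP: $P(s'\mid s,a)=\langle\phi(s,a,s'),\bar\theta\rangle$ for all $s,a,s'$. Moreover $\|\bar\theta\|_2\le 1+\delta/2$, and $\|\bar\theta\|_2\le 1+\delta/3$ if in addition $T\ge\frac{(d-1)^2}{90\,\delta\log 2}$. 2. $\|\phi_F(x_0,a)\|_2\le L$ and $\|\phi_F(x_1,a)\|_2\le L$ for every action $a$, every $L$ and every $F:\{x_0,x_1\}\to[0,L]$. 3. For every $\theta\in\Theta$ the Bellman optimality equation $J^*+q^*(s,a)=r(s,a)+\mathbb E_{s'\sim P(\cdot\mid s,a)}[v^*(s')]$, $v^*(s)=\max_a q^*(s,a)$, of $M_\theta$ has a solution $(J^*,v^*,q^*)$, and for every solution the span $\mathrm{sp}(v^*)=\max_s v^*(s)-\min_s v^*(s)$ satisfies $\frac1{3\delta}\le \mathrm{sp}(v^*)\le\frac1{2\delta}$. 4. For every (randomized, history-dependent) algorithm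 there is $\theta\in\Theta$ such that, when the algorithm interacts with $M_\theta$ for $T$ steps from the initial state $x_0$, the regret $\mathrm{Regret}(T)=T\cdot J^*-\sum_{t=1}^T r(s_t,a_t)$ satisfies $$\mathbb E[\mathrm{Regret}(T)]\ge\frac1{2025}\sqrt{\frac T\delta}\qquad\text{and}\qquad \mathbb E[\mathrm{Regret}(T)]\ge c\,d\sqrt{\mathrm{sp}(v^*)\,T},$$ where $c>0$ is a universal constant that depends on none of $d,T,\delta$, nor on the algorithm. -/

import Mathlib

noncomputable section

namespace AvgRewardMDP

/-! ### Finite Markov decision processes, the Bellman optimality equation, regret -/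

/-- The data of an MDP with state space `S` and action space `A`: `trans s a s'` is the
probability of moving from `s` to `s'` under action `a`, and `reward s a` is the deterministic
reward. The laws these data have to obey are collected in `MDP.IsValid`. -/
structure MDP (S A : Type) where
  trans : S → A → S → ℝ
  reward : S → A → ℝ

variable {S A : Type} [Fintype S] [Fintype A]

/-- Every `trans s a` is a probability distribution and all rewards lie in `[0, 1]`. -/
def MDP.IsValid (M : MDP S A) : Prop :=
  (∀ s a s', 0 ≤ M.trans s a s') ∧ (∀ s a, ∑ s', M.trans s a s' = 1) ∧
    ∀ s a, M.reward s a ∈ Set.Icc (0 : ℝ) 1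

/-- The Bellman optimality equation of the average-reward problem:
`J + q(s,a) = r(s,a) + E_{s' ∼ P(·|s,a)} v(s')` and `v(s) = max_a q(s,a)`. -/
def MDP.BellmanOptimal (M : MDP S A) (J : ℝ) (v : S → ℝ) (q : S → A → ℝ) : Prop :=
  (∀ s a, J + q s a = M.reward s a + ∑ s', M.trans s a s' * v s') ∧
    ∀ s, IsGreatest (Set.range (q s)) (v s)

/-- The span `max h - min h` of a function on a finite nonempty set. -/
def span (h : S → ℝ) : ℝ := (⨆ s, h s) - ⨅ s, h s

/-- A (randomized, history-dependent) learning algorithm: from the past state-action pairs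
`(s_{t-1}, a_{t-1}), …, (s_1, a_1)`, listed with the most recent pair first, and the current state
`s_t`, it produces a probability distribution on the actions, from which `a_t` is drawn. -/
abbrev Algorithm (S A : Type) [Fintype A] := List (S × A) → S → stdSimplex ℝ A

/-- The distribution of the state that follows a past (most recent pair first), when the
process starts in `s₁`. -/
def MDP.nextStateProb [DecidableEq S] (M : MDP S A) (s₁ : S) : List (S × A) → S → ℝ
  | [], s => if s = s₁ then 1 else 0
  | (s', a') :: _, s => M.trans s' a' s

/-- The probability of the trajectory `(s_t, a_t), …, (s_1, a_1)` (most recent pair first) when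
the algorithm `alg` interacts with `M` from the initial state `s₁`. -/
def MDP.trajProb [DecidableEq S] (M : MDP S A) (alg : Algorithm S A) (s₁ : S) :
    List (S × A) → ℝ
  | [] => 1
  | (s, a) :: h => M.trajProb alg s₁ h * M.nextStateProb s₁ h s * (alg h s : A → ℝ) a

/-- `E[∑_{t=1}^T r(s_t, a_t)]`: the expectation, over all trajectories of length `T`, of the
cumulative reward. -/
def MDP.expReward [DecidableEq S] (M : MDP S A) (alg : Algorithm S A) (s₁ : S) (T : ℕ) : ℝ :=
  ∑ τ : List.Vector (S × A) T,
    M.trajProb alg s₁ τ.toList * (τ.toList.map fun x => M.reward x.1 x.2).sum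

/-- `E[Regret(T)] = T · J - E[∑_{t=1}^T r(s_t, a_t)]`, where `J` is the optimal average reward. -/
def MDP.expRegret [DecidableEq S] (M : MDP S A) (J : ℝ) (alg : Algorithm S A) (s₁ : S)
    (T : ℕ) : ℝ :=
  T * J - M.expReward alg s₁ T

/-- `P(s'|s,a) = ⟨φ(s,a,s'), θ⟩` for all `s, a, s'`. -/
def MDP.IsLinearMixture (M : MDP S A) {d : ℕ} (φ : S → A → S → EuclideanSpace ℝ (Fin d))
    (θ : EuclideanSpace ℝ (Fin d)) : Prop :=
  ∀ s a s', M.trans s a s' = inner ℝ (φ s a s') θ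

/-- `φ_F(s,a) = ∑_{s'} F(s') φ(s,a,s')`. -/
def aggFeature {d : ℕ} (φ : S → A → S → EuclideanSpace ℝ (Fin d)) (F : S → ℝ) (s : S) (a : A) :
    EuclideanSpace ℝ (Fin d) :=
  ∑ s', F s' • φ s a s'

/-! ### The two-state instance; the states `x₀, x₁` are `0, 1 : Fin 2` -/

/-- The action set `{-1, 1}^{d-1}`. -/
abbrev Act (d : ℕ) := Fin (d - 1) → ℤˣ

/-- The action as a real vector. -/
def Act.val {d : ℕ} (a : Act d) : Fin (d - 1) → ℝ := fun i => ((a i : ℤ) : ℝ)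

/-- `Δ = (d-1) / (45 √(2 T log 2 / (5δ)))`. -/
def gap (d T : ℕ) (δ : ℝ) : ℝ :=
  ((d : ℝ) - 1) / (45 * Real.sqrt (2 * T * Real.log 2 / (5 * δ)))

/-- `{-Δ/(d-1), Δ/(d-1)}^{d-1}`. -/
def hypercube (d T : ℕ) (δ : ℝ) : Set (Fin (d - 1) → ℝ) :=
  {θ | ∀ i, θ i = -(gap d T δ / ((d : ℝ) - 1)) ∨ θ i = gap d T δ / ((d : ℝ) - 1)}

/-- `α = √(Δ / ((d-1)(1+Δ)))`. -/
def alpha (d T : ℕ) (δ : ℝ) : ℝ :=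
  Real.sqrt (gap d T δ / (((d : ℝ) - 1) * (1 + gap d T δ)))

/-- `β = √(1 / (1+Δ))`. -/
def beta (d T : ℕ) (δ : ℝ) : ℝ := Real.sqrt (1 / (1 + gap d T δ))

/-- The vector `(u, x) ∈ ℝ^d` for `u ∈ ℝ^{d-1}` and `x ∈ ℝ`. -/
def join (d : ℕ) (u : Fin (d - 1) → ℝ) (x : ℝ) : EuclideanSpace ℝ (Fin d) :=
  WithLp.toLp 2 fun i => if h : (i : ℕ) < d - 1 then u ⟨i, h⟩ else x

/-- `θ̄ = (θ/α, 1/β)`. -/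
def thetaBar (d T : ℕ) (δ : ℝ) (θ : Fin (d - 1) → ℝ) : EuclideanSpace ℝ (Fin d) :=
  join d (fun i => θ i / alpha d T δ) (1 / beta d T δ)

/-- `φ(x₀,a,x₀) = (-αa, β(1-δ))`, `φ(x₀,a,x₁) = (αa, βδ)`, `φ(x₁,a,x₀) = (0, βδ)`,
`φ(x₁,a,x₁) = (0, β(1-δ))`. -/
def hardFeature (d T : ℕ) (δ : ℝ) (s : Fin 2) (a : Act d) (s' : Fin 2) :
    EuclideanSpace ℝ (Fin d) :=
  if s = 0 then
    if s' = 0 then join d (fun i => -(alpha d T δ * a.val i)) (beta d T δ * (1 - δ))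
    else join d (fun i => alpha d T δ * a.val i) (beta d T δ * δ)
  else
    if s' = 0 then join d (fun _ => 0) (beta d T δ * δ)
    else join d (fun _ => 0) (beta d T δ * (1 - δ))

/-- The two-state MDP: from `x₀` action `a` leads to `x₁` with probability `δ + ⟨a,θ⟩`, from `x₁`
every action leads to `x₀` with probability `δ`, and otherwise the state does not change; the
reward is `0` in `x₀` and `1` in `x₁`. -/
def hardMDP (d : ℕ) (δ : ℝ) (θ : Fin (d - 1) → ℝ) : MDP (Fin 2) (Act d) where
  trans s a s' :=
    if s = 0 then
      if s' = 0 then 1 - δ - ∑ i, a.val i * θ i else δ + ∑ i, a.val i * θ i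
    else
      if s' = 0 then δ else 1 - δ
  reward s _ := if s = 0 then 0 else 1

end AvgRewardMDP

end

/-!
In the two-state instance the learner has to find `d - 1` unknown signs. Writing
`θ = ε σ` with `ε = Δ / (d - 1)` and a sign vector `σ`, the optimal action in `x₀` is `σ`, each wrong
sign lowers the probability of reaching the rewarding state by `2 ε`, and the Bellman equation has
optimal gain `(δ + Δ) / (2 δ + Δ)` and bias of span `D = 1 / (2 δ + Δ)`.

For the regret, telescoping the Bellman equation along the trajectory (`MDP.mul_le_expTotal`) bounds
it below by `2 ε D` times the expected number of wrong signs played in `x₀`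
(`sum_wrongSign_le_expRegret`); the boundary term has the right sign because `x₀` minimizes the
bias. The same telescoping, with the indicator of `x₀` as potential, shows that every algorithm
spends an expected `δ D T ≥ 40 T / 99` steps or more in `x₀` (`le_expTotal_idle`).

Two instances that differ in the `i`-th sign are hard to distinguish. The Hellinger affinity of the
two trajectory laws is at least the `T`-th power of the worst one-step affinity
(`MDP.pow_le_affinity`), so their total variation distance is at most `7 / 25 < 40 / 99`
(`sum_mul_sub_le_of_affinity`). The affinity is used in place of the Kullback-Leibler divergence
because `1 - δ - Δ` may be as small as about `1 / 60`: there the constants are tight, and Pinsker's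
inequality with the chi-squared bound on the divergence costs a factor two in the squared distance.
As a sign that is right on one of the two instances is wrong on the other, the wrong `i`-th
signs on both add up to at least `(40 / 99 - 7 / 25) T` (`le_expTotal_wrongSign_add`). Averaging over
the cube (`exists_le_sum_wrongSign`) gives an instance with regret at least
`(d - 1) √(T / δ) / 2025`, from which both bounds follow.
-/

namespace AvgRewardMDP

/-! ### Expectations over trajectories -/

theorem sum_vector_zero {α : Type} [Fintype α] (F : List α → ℝ) :
    ∑ τ : List.Vector α 0, F τ.toList = F [] := by
  rw [Fintype.sum_eq_single (List.Vector.nil : List.Vector α 0)]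
  · rfl
  · intro x hx
    exact absurd (List.Vector.eq_nil x) hx

theorem sum_vector_succ {α : Type} [Fintype α] (n : ℕ) (F : List α → ℝ) :
    ∑ τ : List.Vector α (n + 1), F τ.toList
      = ∑ τ : List.Vector α n, ∑ x, F (x :: τ.toList) := by
  rw [← Fintype.sum_prod_type']
  refine (Fintype.sum_equiv
    { toFun := fun p : List.Vector α n × α => p.2 ::ᵥ p.1
      invFun := fun τ => (τ.tail, τ.head)
      left_inv := fun p => by simp
      right_inv := fun τ => by simp } _ _ fun p => ?_).symm
  simp [List.Vector.toList_cons]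

theorem Algorithm.prob_nonneg {S A : Type} [Fintype A] (alg : Algorithm S A)
    (h : List (S × A)) (s : S) (a : A) :
    0 ≤ (alg h s : A → ℝ) a := (alg h s).2.1 a

theorem Algorithm.sum_prob {S A : Type} [Fintype A] (alg : Algorithm S A)
    (h : List (S × A)) (s : S) :
    ∑ a, (alg h s : A → ℝ) a = 1 := (alg h s).2.2

section

variable {S A : Type} [Fintype S] [DecidableEq S] {M : MDP S A} {s₁ : S}

theorem MDP.nextStateProb_nonneg (hM : M.IsValid) (h : List (S × A)) (s : S) :
    0 ≤ M.nextStateProb s₁ h s := by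
  match h with
  | [] => simp only [nextStateProb]; split_ifs <;> norm_num
  | (s', a') :: _ => exact hM.1 s' a' s

theorem MDP.sum_nextStateProb (hM : M.IsValid) (h : List (S × A)) :
    ∑ s, M.nextStateProb s₁ h s = 1 := by
  match h with
  | [] => simp [nextStateProb]
  | (s', a') :: _ => exact hM.2.1 s' a'

variable [Fintype A] {alg : Algorithm S A}

/-- The expectation of `f (history)` after `n` steps of interaction; histories list the most
recent state-action pair first. -/
noncomputable def MDP.expect (M : MDP S A) (alg : Algorithm S A) (s₁ : S) (n : ℕ)
    (f : List (S × A) → ℝ) : ℝ :=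
  ∑ τ : List.Vector (S × A) n, M.trajProb alg s₁ τ.toList * f τ.toList

/-- The expected cumulative value `E[∑ₜ c(sₜ, aₜ)]` of a cost `c` over `n` steps. -/
noncomputable def MDP.expTotal (M : MDP S A) (alg : Algorithm S A) (s₁ : S) (n : ℕ)
    (c : S × A → ℝ) : ℝ :=
  M.expect alg s₁ n fun h => (h.map c).sum

theorem MDP.trajProb_nonneg (hM : M.IsValid) (h : List (S × A)) :
    0 ≤ M.trajProb alg s₁ h := by
  induction h with
  | nil => simp [trajProb]
  | cons x h ih =>
    exact mul_nonneg (mul_nonneg ih (nextStateProb_nonneg hM h x.1))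
      (Algorithm.prob_nonneg alg h x.1 x.2)

theorem MDP.expect_zero (f : List (S × A) → ℝ) : M.expect alg s₁ 0 f = f [] := by
  unfold expect
  rw [sum_vector_zero fun h => M.trajProb alg s₁ h * f h]
  simp [trajProb]

theorem MDP.expect_succ (n : ℕ) (f : List (S × A) → ℝ) :
    M.expect alg s₁ (n + 1) f = M.expect alg s₁ n fun h =>
      ∑ s, M.nextStateProb s₁ h s * ∑ a, (alg h s : A → ℝ) a * f ((s, a) :: h) := by
  unfold expect
  rw [sum_vector_succ n fun h => M.trajProb alg s₁ h * f h]
  refine Finset.sum_congr rfl fun τ _ => ?_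
  rw [Fintype.sum_prod_type, Finset.mul_sum]
  refine Finset.sum_congr rfl fun s _ => ?_
  rw [Finset.mul_sum, Finset.mul_sum]
  refine Finset.sum_congr rfl fun a _ => ?_
  simp only [trajProb]
  ring

theorem MDP.expect_mono (hM : M.IsValid) {n : ℕ} {f g : List (S × A) → ℝ}
    (hfg : ∀ h, f h ≤ g h) : M.expect alg s₁ n f ≤ M.expect alg s₁ n g :=
  Finset.sum_le_sum fun _ _ =>
    mul_le_mul_of_nonneg_left (hfg _) (trajProb_nonneg hM _)

theorem MDP.expect_const (hM : M.IsValid) (n : ℕ) (k : ℝ) :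
    M.expect alg s₁ n (fun _ => k) = k := by
  induction n with
  | zero => exact expect_zero _
  | succ n ih =>
    rw [expect_succ]
    simp only [← Finset.sum_mul, Algorithm.sum_prob, sum_nextStateProb hM, one_mul, ih]

theorem MDP.sum_trajProb (hM : M.IsValid) (n : ℕ) :
    ∑ τ : List.Vector (S × A) n, M.trajProb alg s₁ τ.toList = 1 := by
  simpa [expect] using expect_const (alg := alg) (s₁ := s₁) hM n 1

theorem MDP.expect_add (n : ℕ) (f g : List (S × A) → ℝ) :
    M.expect alg s₁ n (fun h => f h + g h) = M.expect alg s₁ n f + M.expect alg s₁ n g := by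
  simp only [expect, mul_add, Finset.sum_add_distrib]

theorem MDP.expTotal_add (n : ℕ) (c c' : S × A → ℝ) :
    M.expTotal alg s₁ n (fun x => c x + c' x)
      = M.expTotal alg s₁ n c + M.expTotal alg s₁ n c' := by
  simp only [expTotal, List.sum_map_add, expect_add]

theorem MDP.expTotal_const_mul (n : ℕ) (k : ℝ) (c : S × A → ℝ) :
    M.expTotal alg s₁ n (fun x => k * c x) = k * M.expTotal alg s₁ n c := by
  simp only [expTotal, expect, List.sum_map_mul_left, Finset.mul_sum]
  exact Finset.sum_congr rfl fun τ _ => by ring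

theorem MDP.expTotal_sum {ι : Type} (n : ℕ) (t : Finset ι) (c : ι → S × A → ℝ) :
    M.expTotal alg s₁ n (fun x => ∑ i ∈ t, c i x) = ∑ i ∈ t, M.expTotal alg s₁ n (c i) := by
  classical
  induction t using Finset.induction_on with
  | empty => simp [expTotal, expect]
  | insert i t hi ih => simp only [Finset.sum_insert hi, expTotal_add, ih]

/-- Telescoping along the trajectory: if `V` is a potential with `k + V(s) ≤ c(s,a) + E V(s')` which
is maximal at the initial state, then `n` steps cost at least `n k` in expectation. -/
theorem MDP.mul_le_expTotal (hM : M.IsValid) {k : ℝ} {c : S × A → ℝ} {V : S → ℝ}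
    (hV : ∀ s, V s ≤ V s₁)
    (hc : ∀ s a, k + V s ≤ c (s, a) + ∑ s', M.trans s a s' * V s') (n : ℕ) :
    n * k ≤ M.expTotal alg s₁ n c := by
  have key : ∀ n : ℕ, n * k + V s₁ ≤ M.expect alg s₁ n fun h =>
      (h.map c).sum + ∑ s, M.nextStateProb s₁ h s * V s := by
    intro n
    induction n with
    | zero => simp [expect_zero, nextStateProb]
    | succ n ih =>
      have hstep : M.expect alg s₁ n (fun h => k + ((h.map c).sum +
            ∑ s, M.nextStateProb s₁ h s * V s)) ≤
          M.expect alg s₁ (n + 1) fun h =>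
            (h.map c).sum + ∑ s, M.nextStateProb s₁ h s * V s := by
        rw [expect_succ]
        refine expect_mono hM fun h => ?_
        have h1 : k + ((h.map c).sum + ∑ s, M.nextStateProb s₁ h s * V s)
            = ∑ s, M.nextStateProb s₁ h s * ∑ a, (alg h s : A → ℝ) a *
              ((k + V s) + (h.map c).sum) := by
          simp only [← Finset.sum_mul, Algorithm.sum_prob, one_mul, mul_add,
            Finset.sum_add_distrib, sum_nextStateProb hM]
          ring
        rw [h1]
        refine Finset.sum_le_sum fun s _ => mul_le_mul_of_nonneg_left
          (Finset.sum_le_sum fun a _ => mul_le_mul_of_nonneg_left ?_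
            (Algorithm.prob_nonneg alg h s a)) (nextStateProb_nonneg hM h s)
        have := hc s a
        simp only [List.map_cons, List.sum_cons, nextStateProb]
        linarith
      rw [expect_add, expect_const hM] at hstep
      push_cast
      linarith
  have hlast : M.expect alg s₁ n (fun h => (h.map c).sum +
      ∑ s, M.nextStateProb s₁ h s * V s) ≤ M.expTotal alg s₁ n c + V s₁ := by
    rw [expect_add]
    refine add_le_add le_rfl ?_
    rw [← expect_const (alg := alg) (s₁ := s₁) hM n (V s₁)]
    refine expect_mono hM fun h => ?_
    calc ∑ s, M.nextStateProb s₁ h s * V s ≤ ∑ s, M.nextStateProb s₁ h s * V s₁ :=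
          Finset.sum_le_sum fun s _ =>
            mul_le_mul_of_nonneg_left (hV s) (nextStateProb_nonneg hM h s)
      _ = V s₁ := by rw [← Finset.sum_mul, sum_nextStateProb hM, one_mul]
  linarith [key n]

/-! ### Hellinger affinity and change of measure -/

/-- Two distributions with Hellinger affinity `∑ √(P Q) ≥ ρ` have total variation distance at most
`√(1 - ρ²)`, hence give expectations of a `[0, B]`-valued `f` that differ by at most `B √(1 - ρ²)`. -/
theorem sum_mul_sub_le_of_affinity {ι : Type} [Fintype ι] {P Q f : ι → ℝ} {B ρ : ℝ}
    (hP : ∀ i, 0 ≤ P i) (hQ : ∀ i, 0 ≤ Q i) (hP1 : ∑ i, P i = 1) (hQ1 : ∑ i, Q i = 1)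
    (hf : ∀ i, f i ∈ Set.Icc 0 B) (hB : 0 ≤ B) (hρ : 0 ≤ ρ)
    (hPQ : ρ ≤ ∑ i, √(P i * Q i)) :
    ∑ i, P i * f i - ∑ i, Q i * f i ≤ B * √(1 - ρ ^ 2) := by
  set b := ∑ i, √(P i * Q i) with hb
  have hminus : ∑ i, (√(P i) - √(Q i)) ^ 2 = 2 - 2 * b := by
    have : ∀ i, (√(P i) - √(Q i)) ^ 2 = P i + Q i - 2 * √(P i * Q i) := fun i => by
      rw [Real.sqrt_mul (hP i), sub_sq, Real.sq_sqrt (hP i), Real.sq_sqrt (hQ i)]; ring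
    simp only [this, Finset.sum_sub_distrib, Finset.sum_add_distrib, ← Finset.mul_sum, hP1, hQ1]
    rw [hb]; ring
  have hplus : ∑ i, (√(P i) + √(Q i)) ^ 2 = 2 + 2 * b := by
    have : ∀ i, (√(P i) + √(Q i)) ^ 2 = P i + Q i + 2 * √(P i * Q i) := fun i => by
      rw [Real.sqrt_mul (hP i), add_sq, Real.sq_sqrt (hP i), Real.sq_sqrt (hQ i)]; ring
    simp only [this, Finset.sum_add_distrib, ← Finset.mul_sum, hP1, hQ1]
    rw [hb]; ring
  have habs : ∀ i, |P i - Q i| = |√(P i) - √(Q i)| * (√(P i) + √(Q i)) := fun i => by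
    rw [← abs_of_nonneg (add_nonneg (Real.sqrt_nonneg (P i)) (Real.sqrt_nonneg (Q i))), ← abs_mul]
    congr 1
    nlinarith [Real.sq_sqrt (hP i), Real.sq_sqrt (hQ i)]
  have hTV : ∑ i, |P i - Q i| ≤ 2 * √(1 - ρ ^ 2) := by
    have hCS := Finset.sum_mul_sq_le_sq_mul_sq Finset.univ
      (fun i => |√(P i) - √(Q i)|) (fun i => √(P i) + √(Q i))
    simp only [sq_abs, hminus, hplus, ← habs] at hCS
    rw [show (2 : ℝ) = √4 by rw [show (4 : ℝ) = 2 ^ 2 by norm_num]; simp,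
      ← Real.sqrt_mul (by norm_num)]
    refine Real.le_sqrt_of_sq_le (hCS.trans ?_)
    nlinarith
  -- subtracting `B / 2` from `f` costs nothing, as both measures have mass one
  have hcenter : ∑ i, P i * f i - ∑ i, Q i * f i = ∑ i, (P i - Q i) * (f i - B / 2) := by
    simp only [sub_mul, mul_sub, Finset.sum_sub_distrib, ← Finset.sum_mul, hP1, hQ1]
    ring
  rw [hcenter]
  calc ∑ i, (P i - Q i) * (f i - B / 2) ≤ ∑ i, |P i - Q i| * (B / 2) := by
        refine Finset.sum_le_sum fun i _ => (le_abs_self _).trans ?_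
        rw [abs_mul]
        refine mul_le_mul_of_nonneg_left ?_ (abs_nonneg _)
        rw [abs_le]
        constructor <;> linarith [(hf i).1, (hf i).2]
    _ = (∑ i, |P i - Q i|) * (B / 2) := (Finset.sum_mul _ _ _).symm
    _ ≤ 2 * √(1 - ρ ^ 2) * (B / 2) := mul_le_mul_of_nonneg_right hTV (by linarith)
    _ = B * √(1 - ρ ^ 2) := by ring

/-- The Hellinger affinity is multiplicative along the trajectory: if every pair of one-step
transition laws has affinity at least `b`, the laws of the first `n` steps have affinity at least
`b ^ n`, whatever the algorithm. -/
theorem MDP.pow_le_affinity {M' : MDP S A} (hM : M.IsValid) (hM' : M'.IsValid) {b : ℝ}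
    (hb0 : 0 ≤ b) (hb1 : b ≤ 1)
    (hb : ∀ s a, b ≤ ∑ s', √(M.trans s a s' * M'.trans s a s')) (n : ℕ) :
    b ^ n ≤ ∑ τ : List.Vector (S × A) n,
      √(M.trajProb alg s₁ τ.toList * M'.trajProb alg s₁ τ.toList) := by
  have hnext : ∀ h, b ≤ ∑ s, √(M.nextStateProb s₁ h s * M'.nextStateProb s₁ h s) := by
    intro h
    match h with
    | [] =>
      refine hb1.trans (le_of_eq ?_)
      rw [Finset.sum_eq_single s₁] <;> simp +contextual [nextStateProb]
    | (s', a') :: _ => exact hb s' a'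
  induction n with
  | zero =>
    rw [sum_vector_zero fun h => √(M.trajProb alg s₁ h * M'.trajProb alg s₁ h)]
    simp [trajProb]
  | succ n ih =>
    rw [sum_vector_succ n fun h => √(M.trajProb alg s₁ h * M'.trajProb alg s₁ h), pow_succ]
    refine (mul_le_mul_of_nonneg_right ih hb0).trans ?_
    rw [Finset.sum_mul]
    refine Finset.sum_le_sum fun τ _ => ?_
    set h := τ.toList
    have hfactor : ∀ s a, √(M.trajProb alg s₁ ((s, a) :: h) * M'.trajProb alg s₁ ((s, a) :: h))
        = √(M.trajProb alg s₁ h * M'.trajProb alg s₁ h) *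
          √(M.nextStateProb s₁ h s * M'.nextStateProb s₁ h s) * (alg h s : A → ℝ) a := by
      intro s a
      have h0 := mul_nonneg (trajProb_nonneg (alg := alg) (s₁ := s₁) hM h)
        (trajProb_nonneg (alg := alg) (s₁ := s₁) hM' h)
      have h1 := mul_nonneg (nextStateProb_nonneg (s₁ := s₁) hM h s)
        (nextStateProb_nonneg (s₁ := s₁) hM' h s)
      rw [← Real.sqrt_mul h0, ← Real.sqrt_sq (Algorithm.prob_nonneg alg h s a),
        ← Real.sqrt_mul (mul_nonneg h0 h1)]
      simp only [trajProb]
      congr 1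
      ring
    rw [Fintype.sum_prod_type]
    simp only [hfactor, ← Finset.mul_sum, Algorithm.sum_prob, mul_one]
    exact mul_le_mul_of_nonneg_left (hnext h) (Real.sqrt_nonneg _)

/-- A lower bound on the geometric mean by the arithmetic mean, from
`(√p - √q)² = (p - q)² / (√p + √q)²`. -/
theorem sqrt_mul_ge {m p q : ℝ} (hm : 0 < m) (hp : m ≤ p) (hq : m ≤ q) :
    (p + q) / 2 - (p - q) ^ 2 / (8 * m) ≤ √(p * q) := by
  have hp0 : 0 ≤ p := by linarith
  have hq0 : 0 ≤ q := by linarith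
  have hsp : √m ≤ √p := Real.sqrt_le_sqrt hp
  have hsq : √m ≤ √q := Real.sqrt_le_sqrt hq
  have hm' := Real.sq_sqrt hm.le
  have hp' := Real.sq_sqrt hp0
  have hq' := Real.sq_sqrt hq0
  rw [Real.sqrt_mul hp0]
  have h4 : 4 * m ≤ (√p + √q) ^ 2 := by nlinarith [Real.sqrt_nonneg m]
  have hprod : (p - q) ^ 2 = (√p - √q) ^ 2 * (√p + √q) ^ 2 := by
    rw [← mul_pow]
    congr 1
    nlinarith
  have : (√p - √q) ^ 2 ≤ (p - q) ^ 2 / (4 * m) := by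
    rw [le_div_iff₀ (by linarith), hprod]
    exact mul_le_mul_of_nonneg_left h4 (sq_nonneg _)
  have h8 : (p - q) ^ 2 / (8 * m) = (p - q) ^ 2 / (4 * m) / 2 := by
    field_simp; ring
  rw [h8]
  nlinarith

end

/-! ### Features of the two-state instance -/

theorem cast_pred {d : ℕ} (hd : 2 ≤ d) : ((d - 1 : ℕ) : ℝ) = (d : ℝ) - 1 := by
  push_cast [Nat.one_le_of_lt hd]; ring

theorem inner_join {d : ℕ} (hd : 2 ≤ d) (u w : Fin (d - 1) → ℝ) (x y : ℝ) :
    inner ℝ (join d u x) (join d w y) = ∑ i, u i * w i + x * y := by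
  obtain ⟨n, rfl⟩ : ∃ n, d = n + 1 := ⟨d - 1, by omega⟩
  simp only [join, PiLp.inner_apply, Fin.sum_univ_castSucc]
  simp [mul_comm]

theorem norm_join_sq {d : ℕ} (hd : 2 ≤ d) (u : Fin (d - 1) → ℝ) (x : ℝ) :
    ‖join d u x‖ ^ 2 = ∑ i, u i ^ 2 + x ^ 2 := by
  rw [← real_inner_self_eq_norm_sq, inner_join hd]
  simp only [sq]

theorem Act.val_sq {d : ℕ} (a : Act d) (i : Fin (d - 1)) : a.val i ^ 2 = 1 := by
  rcases Int.units_eq_one_or (a i) with h | h <;> simp [Act.val, h]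

theorem gap_pos {d T : ℕ} {δ : ℝ} (hd : 2 ≤ d) (hδ : 0 < δ) (hT : 0 < T) : 0 < gap d T δ := by
  have : (2 : ℝ) ≤ d := by exact_mod_cast hd
  have : (0 : ℝ) < T := by exact_mod_cast hT
  have := Real.log_pos one_lt_two
  exact div_pos (by linarith) (by positivity)

theorem alpha_pos {d T : ℕ} {δ : ℝ} (hd : 2 ≤ d) (hg : 0 < gap d T δ) : 0 < alpha d T δ := by
  have : (2 : ℝ) ≤ d := by exact_mod_cast hd
  exact Real.sqrt_pos.2 (div_pos hg (mul_pos (by linarith) (by linarith)))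

theorem alpha_sq {d T : ℕ} {δ : ℝ} (hd : 2 ≤ d) (hg : 0 < gap d T δ) :
    alpha d T δ ^ 2 = gap d T δ / (((d : ℝ) - 1) * (1 + gap d T δ)) := by
  have : (2 : ℝ) ≤ d := by exact_mod_cast hd
  exact Real.sq_sqrt (div_pos hg (mul_pos (by linarith) (by linarith))).le

theorem beta_pos {d T : ℕ} {δ : ℝ} (hg : 0 < gap d T δ) : 0 < beta d T δ :=
  Real.sqrt_pos.2 (by positivity)

theorem beta_sq {d T : ℕ} {δ : ℝ} (hg : 0 < gap d T δ) :
    beta d T δ ^ 2 = 1 / (1 + gap d T δ) :=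
  Real.sq_sqrt (by positivity)

theorem sq_of_mem_hypercube {d T : ℕ} {δ : ℝ} {θ : Fin (d - 1) → ℝ} (hθ : θ ∈ hypercube d T δ)
    (i : Fin (d - 1)) : θ i ^ 2 = (gap d T δ / ((d : ℝ) - 1)) ^ 2 := by
  rcases hθ i with h | h <;> rw [h]
  ring

theorem norm_thetaBar {d T : ℕ} {δ : ℝ} (hd : 2 ≤ d) (hg : 0 < gap d T δ)
    {θ : Fin (d - 1) → ℝ} (hθ : θ ∈ hypercube d T δ) :
    ‖thetaBar d T δ θ‖ = 1 + gap d T δ := by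
  have hd' : (0 : ℝ) < (d : ℝ) - 1 := by
    have : (2 : ℝ) ≤ d := by exact_mod_cast hd
    linarith
  rw [← sq_eq_sq₀ (norm_nonneg _) (by linarith), thetaBar, norm_join_sq hd]
  simp only [div_pow, sq_of_mem_hypercube hθ, alpha_sq hd hg, beta_sq hg, Finset.sum_const,
    Finset.card_univ, Fintype.card_fin, nsmul_eq_mul, cast_pred hd]
  field_simp
  ring

theorem hardMDP_isLinearMixture {d T : ℕ} {δ : ℝ} (hd : 2 ≤ d) (hg : 0 < gap d T δ)
    (θ : Fin (d - 1) → ℝ) :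
    (hardMDP d δ θ).IsLinearMixture (hardFeature d T δ) (thetaBar d T δ θ) := by
  have hα := (alpha_pos hd hg).ne'
  have hβ := (beta_pos hg).ne'
  have hc : ∀ x y : ℝ, alpha d T δ * x * (y / alpha d T δ) = x * y := fun x y => by field_simp
  intro s a s'
  fin_cases s <;> fin_cases s' <;>
    simp [hardMDP, hardFeature, thetaBar, inner_join hd, hc] <;> field_simp <;> ring

theorem norm_aggFeature_le {d T : ℕ} {δ : ℝ} (hd : 2 ≤ d) (hg : 0 < gap d T δ)
    (hδ : 0 ≤ δ) (hδ1 : δ ≤ 1) {L : ℝ} {F : Fin 2 → ℝ} (hF : ∀ s, F s ∈ Set.Icc 0 L)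
    (s : Fin 2) (a : Act d) : ‖aggFeature (hardFeature d T δ) F s a‖ ≤ L := by
  have hd' : (0 : ℝ) < (d : ℝ) - 1 := by
    have : (2 : ℝ) ≤ d := by exact_mod_cast hd
    linarith
  have h00 := (hF 0).1
  have h0L := (hF 0).2
  have h10 := (hF 1).1
  have h1L := (hF 1).2
  have hL : 0 ≤ L := h00.trans h0L
  have hg1 : 0 < 1 + gap d T δ := by linarith
  have hmix : ∀ x y : ℝ, x ∈ Set.Icc 0 L → y ∈ Set.Icc 0 L →
      (x * (1 - δ) + y * δ) ^ 2 ≤ L ^ 2 := fun x y hx hy => by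
    refine pow_le_pow_left₀ ?_ ?_ 2
    · have := mul_nonneg hx.1 (sub_nonneg.2 hδ1)
      have := mul_nonneg hy.1 hδ
      linarith
    · have := mul_le_mul_of_nonneg_right hx.2 (sub_nonneg.2 hδ1)
      have := mul_le_mul_of_nonneg_right hy.2 hδ
      linarith
  have hdiff : (F 1 - F 0) ^ 2 ≤ L ^ 2 := sq_le_sq' (by linarith) (by linarith)
  rw [← sq_le_sq₀ (norm_nonneg _) hL]
  have hsmul : ∀ (u₀ u₁ : Fin (d - 1) → ℝ) (x₀ x₁ : ℝ), F 0 • join d u₀ x₀ + F 1 • join d u₁ x₁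
      = join d (fun i => F 0 * u₀ i + F 1 * u₁ i) (F 0 * x₀ + F 1 * x₁) := by
    intro u₀ u₁ x₀ x₁
    ext i
    simp only [join, PiLp.add_apply, PiLp.smul_apply, smul_eq_mul]
    split_ifs <;> rfl
  fin_cases s
  · have h : aggFeature (hardFeature d T δ) F 0 a
        = join d (fun i => F 0 * -(alpha d T δ * a.val i) + F 1 * (alpha d T δ * a.val i))
          (F 0 * (beta d T δ * (1 - δ)) + F 1 * (beta d T δ * δ)) := by
      rw [← hsmul]
      simp [aggFeature, hardFeature, Fin.sum_univ_two]
    have hsum : ∑ i, (F 0 * -(alpha d T δ * a.val i) + F 1 * (alpha d T δ * a.val i)) ^ 2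
        = gap d T δ / (1 + gap d T δ) * (F 1 - F 0) ^ 2 := by
      have : ∀ i, (F 0 * -(alpha d T δ * a.val i) + F 1 * (alpha d T δ * a.val i)) ^ 2
          = gap d T δ / (((d : ℝ) - 1) * (1 + gap d T δ)) * (F 1 - F 0) ^ 2 := fun i => by
        rw [← alpha_sq hd hg, ← mul_one (_ * (F 1 - F 0) ^ 2), ← a.val_sq i]
        ring
      simp only [this, Finset.sum_const, Finset.card_univ, Fintype.card_fin, nsmul_eq_mul,
        cast_pred hd]
      field_simp
    have hlast : (F 0 * (beta d T δ * (1 - δ)) + F 1 * (beta d T δ * δ)) ^ 2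
        = 1 / (1 + gap d T δ) * (F 0 * (1 - δ) + F 1 * δ) ^ 2 := by
      rw [← beta_sq hg]; ring
    change ‖aggFeature (hardFeature d T δ) F 0 a‖ ^ 2 ≤ L ^ 2
    rw [h, norm_join_sq hd, hsum, hlast]
    -- the weights `Δ / (1 + Δ)` and `1 / (1 + Δ)` add up to one
    calc _ ≤ gap d T δ / (1 + gap d T δ) * L ^ 2 + 1 / (1 + gap d T δ) * L ^ 2 :=
          add_le_add (mul_le_mul_of_nonneg_left hdiff (by positivity))
            (mul_le_mul_of_nonneg_left (hmix _ _ (hF 0) (hF 1)) (by positivity))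
      _ = L ^ 2 := by field_simp; ring
  · have h : aggFeature (hardFeature d T δ) F 1 a
        = join d (fun _ => F 0 * 0 + F 1 * 0)
          (F 0 * (beta d T δ * δ) + F 1 * (beta d T δ * (1 - δ))) := by
      rw [← hsmul]
      simp [aggFeature, hardFeature, Fin.sum_univ_two]
    have hlast : (F 0 * (beta d T δ * δ) + F 1 * (beta d T δ * (1 - δ))) ^ 2
        = 1 / (1 + gap d T δ) * (F 1 * (1 - δ) + F 0 * δ) ^ 2 := by
      rw [← beta_sq hg]; ring
    change ‖aggFeature (hardFeature d T δ) F 1 a‖ ^ 2 ≤ L ^ 2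
    rw [h, norm_join_sq hd, hlast]
    simp only [mul_zero, add_zero, ne_eq, OfNat.ofNat_ne_zero, not_false_eq_true, zero_pow,
      Finset.sum_const_zero, zero_add]
    calc _ ≤ 1 * L ^ 2 := mul_le_mul ((div_le_one hg1).2 (by linarith))
          (hmix _ _ (hF 1) (hF 0)) (sq_nonneg _) zero_le_one
      _ = L ^ 2 := one_mul _

/-! ### The Bellman equation of the two-state instance -/

/-- The point `ε σ` of the cube `{-ε, ε}^{d-1}` given by a sign vector `σ`; the action `σ` is the
optimal one for this parameter. -/
noncomputable def cubePoint {d : ℕ} (ε : ℝ) (σ : Act d) : Fin (d - 1) → ℝ := fun i => σ.val i * ε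

theorem exists_eq_cubePoint {d T : ℕ} {δ : ℝ} {θ : Fin (d - 1) → ℝ} (hθ : θ ∈ hypercube d T δ) :
    ∃ σ : Act d, θ = cubePoint (gap d T δ / ((d : ℝ) - 1)) σ := by
  have : ∀ i, ∃ e : ℤˣ, θ i = ((e : ℤ) : ℝ) * (gap d T δ / ((d : ℝ) - 1)) := fun i => by
    rcases hθ i with h | h
    · exact ⟨-1, by simp [h]⟩
    · exact ⟨1, by simp [h]⟩
  choose σ hσ using this
  exact ⟨σ, funext hσ⟩

theorem cubePoint_mem_hypercube {d T : ℕ} {δ : ℝ} (σ : Act d) :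
    cubePoint (gap d T δ / ((d : ℝ) - 1)) σ ∈ hypercube d T δ := by
  intro i
  rcases Int.units_eq_one_or (σ i) with h | h <;> simp [cubePoint, Act.val, h]

/-- The loss of an action against the optimal one is `2 ε` for each wrong sign. -/
theorem sum_val_mul_cubePoint {d : ℕ} (ε : ℝ) (a σ : Act d) :
    ∑ i, a.val i * cubePoint ε σ i
      = (d - 1 : ℕ) * ε - 2 * ε * ∑ i, if a i ≠ σ i then 1 else 0 := by
  have : ∀ i, a.val i * cubePoint ε σ i = ε - 2 * ε * if a i ≠ σ i then 1 else 0 := fun i => by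
    rcases Int.units_eq_one_or (a i) with h | h <;> rcases Int.units_eq_one_or (σ i) with h' | h' <;>
      simp [cubePoint, Act.val, h, h'] <;> ring
  simp only [this, Finset.sum_sub_distrib, ← Finset.mul_sum, Finset.sum_const, Finset.card_univ,
    Fintype.card_fin, nsmul_eq_mul]

theorem sum_val_mul_cubePoint_self {d : ℕ} (ε : ℝ) (σ : Act d) :
    ∑ i, σ.val i * cubePoint ε σ i = (d - 1 : ℕ) * ε := by
  rw [sum_val_mul_cubePoint]; simp

theorem abs_sum_val_mul_cubePoint_le {d : ℕ} {ε : ℝ} (hε : 0 ≤ ε) (a σ : Act d) :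
    |∑ i, a.val i * cubePoint ε σ i| ≤ (d - 1 : ℕ) * ε := by
  have h0 : (0 : ℝ) ≤ ∑ i, if a i ≠ σ i then (1 : ℝ) else 0 :=
    Finset.sum_nonneg fun i _ => by split_ifs <;> norm_num
  have h1 : (∑ i, if a i ≠ σ i then (1 : ℝ) else 0) ≤ (d - 1 : ℕ) := by
    refine (Finset.sum_le_card_nsmul _ _ 1 fun i _ => ?_).trans (by simp)
    split_ifs <;> norm_num
  rw [sum_val_mul_cubePoint, abs_le]
  constructor <;> nlinarith

theorem hardMDP_isValid {d : ℕ} {δ ε : ℝ} (hε : 0 ≤ ε) (hδ : (d - 1 : ℕ) * ε ≤ δ)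
    (hδ1 : δ + (d - 1 : ℕ) * ε ≤ 1) (σ : Act d) : (hardMDP d δ (cubePoint ε σ)).IsValid := by
  have h0 : 0 ≤ (d - 1 : ℕ) * ε := by positivity
  refine ⟨fun s a s' => ?_, fun s a => ?_, fun s a => ?_⟩
  · have := abs_le.1 (abs_sum_val_mul_cubePoint_le hε a σ)
    simp only [hardMDP]
    split_ifs <;> linarith [this.1, this.2]
  · fin_cases s <;> simp [hardMDP, Fin.sum_univ_two]
  · simp only [hardMDP]
    split_ifs <;> simp

theorem hardMDP_exists_bellmanOptimal {d : ℕ} {δ ε : ℝ} (hε : 0 ≤ ε) (hδ : 0 < δ) (σ : Act d) :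
    ∃ J v q, (hardMDP d δ (cubePoint ε σ)).BellmanOptimal J v q := by
  set Δ : ℝ := (d - 1 : ℕ) * ε with hΔ
  have hΔ0 : 0 ≤ Δ := by positivity
  have hD : 0 < 2 * δ + Δ := by linarith
  refine ⟨(δ + Δ) / (2 * δ + Δ), fun s => if s = 0 then 0 else 1 / (2 * δ + Δ),
    fun s a => if s = 0 then
      (δ + ∑ i, a.val i * cubePoint ε σ i) / (2 * δ + Δ) - (δ + Δ) / (2 * δ + Δ)
      else 1 / (2 * δ + Δ), fun s a => ?_, fun s => ?_⟩
  · fin_cases s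
    · simp [hardMDP, Fin.sum_univ_two]
      field_simp
    · simp [hardMDP, Fin.sum_univ_two]
      field_simp
      ring
  · fin_cases s
    · refine ⟨⟨σ, ?_⟩, ?_⟩
      · simp only [sum_val_mul_cubePoint_self, ← hΔ]; simp
      · rintro _ ⟨a, rfl⟩
        have := (abs_le.1 (abs_sum_val_mul_cubePoint_le hε a σ)).2
        simp only [Fin.zero_eta, if_true, sub_nonpos]
        gcongr
    · exact ⟨⟨σ, by simp⟩, by rintro _ ⟨a, rfl⟩; simp⟩

theorem hardMDP_bellmanOptimal_unique {d : ℕ} {δ ε : ℝ} (hε : 0 ≤ ε) (hδ : 0 < δ)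
    (hΔδ : (d - 1 : ℕ) * ε ≤ δ) (σ : Act d) {J : ℝ} {v : Fin 2 → ℝ} {q : Fin 2 → Act d → ℝ}
    (h : (hardMDP d δ (cubePoint ε σ)).BellmanOptimal J v q) :
    J = (δ + (d - 1 : ℕ) * ε) / (2 * δ + (d - 1 : ℕ) * ε) ∧
      span v = 1 / (2 * δ + (d - 1 : ℕ) * ε) := by
  set Δ : ℝ := (d - 1 : ℕ) * ε with hΔ
  have hΔ0 : 0 ≤ Δ := by positivity
  have hD : 0 < 2 * δ + Δ := by linarith
  obtain ⟨hq, hv⟩ := h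
  have hq0 : ∀ a, J + q 0 a = v 0 + (δ + ∑ i, a.val i * cubePoint ε σ i) * (v 1 - v 0) :=
    fun a => by
      rw [hq 0 a]; simp [hardMDP, Fin.sum_univ_two]; ring
  have hq1 : ∀ a, J + q 1 a = 1 + v 1 - δ * (v 1 - v 0) := fun a => by
    rw [hq 1 a]; simp [hardMDP, Fin.sum_univ_two]; ring
  obtain ⟨⟨a₀, ha₀⟩, hmax⟩ := hv 0
  obtain ⟨⟨a₁, ha₁⟩, -⟩ := hv 1
  have e1 : J = 1 - δ * (v 1 - v 0) := by linarith [hq1 a₁]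
  have e0 : J = (δ + ∑ i, a₀.val i * cubePoint ε σ i) * (v 1 - v 0) := by linarith [hq0 a₀]
  have hle : (δ + Δ) * (v 1 - v 0) ≤ J := by
    have := hmax ⟨σ, rfl⟩
    have h2 := hq0 σ
    rw [sum_val_mul_cubePoint_self] at h2
    linarith
  have hab := abs_le.1 (abs_sum_val_mul_cubePoint_le hε a₀ σ)
  have hpos : 0 < v 1 - v 0 := by
    by_contra hneg
    push Not at hneg
    have : (δ + ∑ i, a₀.val i * cubePoint ε σ i) * (v 1 - v 0) ≤ 0 :=
      mul_nonpos_of_nonneg_of_nonpos (by linarith [hab.1]) hneg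
    nlinarith
  have hge : J ≤ (δ + Δ) * (v 1 - v 0) := by
    rw [e0]
    exact mul_le_mul_of_nonneg_right (by linarith [hab.2]) hpos.le
  have hdiff : v 1 - v 0 = 1 / (2 * δ + Δ) := by
    rw [eq_div_iff hD.ne']; linarith
  refine ⟨?_, ?_⟩
  · rw [le_antisymm hge hle, hdiff]; ring
  · have hsup : IsGreatest (Set.range v) (v 1) :=
      ⟨⟨1, rfl⟩, by rintro _ ⟨s, rfl⟩; fin_cases s <;> simp; linarith⟩
    have hinf : IsLeast (Set.range v) (v 0) :=
      ⟨⟨0, rfl⟩, by rintro _ ⟨s, rfl⟩; fin_cases s <;> simp; linarith⟩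
    rw [span, iSup, iInf, hsup.csSup_eq, hinf.csInf_eq, hdiff]

/-! ### Regret and wrong signs -/

section

variable {d : ℕ}

/-- The indicator of being in the idle state `x₀`. -/
def idle (x : Fin 2 × Act d) : ℝ := if x.1 = 0 then 1 else 0

/-- The indicator of playing, in the idle state `x₀`, an action whose `i`-th sign differs from that
of the optimal action `σ`. -/
def wrongSign (σ : Act d) (i : Fin (d - 1)) (x : Fin 2 × Act d) : ℝ :=
  if x.1 = 0 ∧ x.2 i ≠ σ i then 1 else 0

/-- The sign vector `σ` with its `i`-th sign reversed. -/
def flipSign (i : Fin (d - 1)) (σ : Act d) : Act d := Function.update σ i (-σ i)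

theorem flipSign_involutive (i : Fin (d - 1)) : Function.Involutive (flipSign i) := fun σ => by
  simp [flipSign]

theorem wrongSign_flipSign (σ : Act d) (i : Fin (d - 1)) (x : Fin 2 × Act d) :
    wrongSign (flipSign i σ) i x = idle x + -1 * wrongSign σ i x := by
  rcases Int.units_eq_one_or (x.2 i) with h | h <;> rcases Int.units_eq_one_or (σ i) with h' | h' <;>
    by_cases hx : x.1 = 0 <;> simp [wrongSign, idle, flipSign, h, h', hx]

theorem sum_val_mul_cubePoint_sub_flipSign_sq (ε : ℝ) (a σ : Act d) (i : Fin (d - 1)) :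
    (∑ j, a.val j * cubePoint ε σ j - ∑ j, a.val j * cubePoint ε (flipSign i σ) j) ^ 2
      = 4 * ε ^ 2 := by
  have : ∑ j, a.val j * cubePoint ε σ j - ∑ j, a.val j * cubePoint ε (flipSign i σ) j
      = 2 * ε * (a.val i * σ.val i) := by
    rw [← Finset.sum_sub_distrib, Finset.sum_eq_single i]
    · simp [cubePoint, flipSign, Act.val]; ring
    · intro j _ hj
      simp [cubePoint, flipSign, Act.val, Function.update_of_ne hj]
    · simp
  rw [this, mul_pow, mul_pow, mul_pow, Act.val_sq, Act.val_sq]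
  ring

variable {δ ε : ℝ} {alg : Algorithm (Fin 2) (Act d)}

/-- The regret is at least the sum of the losses in the Bellman equation: each wrong sign played in
`x₀` loses `2 ε` times the span of the bias. -/
theorem sum_wrongSign_le_expRegret (hε : 0 ≤ ε) (hδ : 0 < δ) (hΔδ : (d - 1 : ℕ) * ε ≤ δ)
    (hδ1 : δ + (d - 1 : ℕ) * ε ≤ 1) (σ : Act d) (T : ℕ) :
    2 * ε / (2 * δ + (d - 1 : ℕ) * ε) *
        ∑ i, (hardMDP d δ (cubePoint ε σ)).expTotal alg 0 T (wrongSign σ i)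
      ≤ (hardMDP d δ (cubePoint ε σ)).expRegret
          ((δ + (d - 1 : ℕ) * ε) / (2 * δ + (d - 1 : ℕ) * ε)) alg 0 T := by
  set M := hardMDP d δ (cubePoint ε σ)
  set Δ : ℝ := (d - 1 : ℕ) * ε with hΔ
  have hΔ0 : 0 ≤ Δ := by positivity
  have hD : 0 < 2 * δ + Δ := by linarith
  have h := MDP.mul_le_expTotal (alg := alg) (s₁ := 0) (hardMDP_isValid hε hΔδ hδ1 σ)
    (k := -((δ + Δ) / (2 * δ + Δ)))
    (c := fun x => -1 * (M.reward x.1 x.2 + 2 * ε / (2 * δ + Δ) * ∑ i, wrongSign σ i x))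
    (V := fun s => if s = 0 then 0 else -(1 / (2 * δ + Δ)))
    (fun s => by
      have : 0 ≤ 1 / (2 * δ + Δ) := by positivity
      split_ifs <;> simp_all)
    (fun s a => by
      refine le_of_eq ?_
      fin_cases s
      · simp [M, hardMDP, Fin.sum_univ_two, wrongSign, sum_val_mul_cubePoint, ← hΔ]
        field_simp
        ring
      · simp [M, hardMDP, Fin.sum_univ_two, wrongSign]
        field_simp
        ring) T
  rw [MDP.expTotal_const_mul, MDP.expTotal_add, MDP.expTotal_const_mul, MDP.expTotal_sum] at h
  have hr : M.expTotal alg 0 T (fun x => M.reward x.1 x.2) = M.expReward alg 0 T := rfl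
  rw [hr] at h
  rw [MDP.expRegret]
  linarith

/-- Whatever the algorithm, a constant expected fraction of the time is spent in the idle state. -/
theorem le_expTotal_idle (hε : 0 ≤ ε) (hΔδ : (d - 1 : ℕ) * ε ≤ δ)
    (hδ1 : δ + (d - 1 : ℕ) * ε ≤ 1) (σ : Act d) (T : ℕ) :
    T * δ ≤ (2 * δ + (d - 1 : ℕ) * ε) *
      (hardMDP d δ (cubePoint ε σ)).expTotal alg 0 T idle := by
  rw [← MDP.expTotal_const_mul]
  refine MDP.mul_le_expTotal (hardMDP_isValid hε hΔδ hδ1 σ)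
    (V := fun s => if s = 0 then 1 else 0) (fun s => ?_) (fun s a => ?_) T
  · split_ifs <;> simp_all
  · have := (abs_le.1 (abs_sum_val_mul_cubePoint_le hε a σ)).2
    fin_cases s
    · simp [hardMDP, idle]
      linarith
    · simp [hardMDP, idle]

/-- Two instances whose parameters differ in one sign have nearly the same transition laws. -/
theorem le_sum_sqrt_trans_mul (hε : 0 ≤ ε) (hδ : 0 ≤ δ) (hδ1 : δ ≤ 1) {m m' : ℝ} (hm : 0 < m)
    (hm' : 0 < m') (hmδ : m ≤ δ - (d - 1 : ℕ) * ε) (hmδ' : m' ≤ 1 - δ - (d - 1 : ℕ) * ε)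
    (σ : Act d) (i : Fin (d - 1)) (s : Fin 2) (a : Act d) :
    1 - ε ^ 2 / 2 * (1 / m + 1 / m') ≤ ∑ s', √((hardMDP d δ (cubePoint ε σ)).trans s a s' *
      (hardMDP d δ (cubePoint ε (flipSign i σ))).trans s a s') := by
  have h1 := abs_le.1 (abs_sum_val_mul_cubePoint_le hε a σ)
  have h2 := abs_le.1 (abs_sum_val_mul_cubePoint_le hε a (flipSign i σ))
  have h3 := sum_val_mul_cubePoint_sub_flipSign_sq ε a σ i
  fin_cases s
  · simp only [hardMDP, Fin.sum_univ_two, Fin.zero_eta, if_true, one_ne_zero, if_false]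
    set x := ∑ j, a.val j * cubePoint ε σ j
    set y := ∑ j, a.val j * cubePoint ε (flipSign i σ) j
    have hp := sqrt_mul_ge (p := δ + x) (q := δ + y) hm (by linarith) (by linarith)
    have hq := sqrt_mul_ge (p := 1 - δ - x) (q := 1 - δ - y) hm' (by linarith) (by linarith)
    have e1 : (δ + x - (δ + y)) ^ 2 = 4 * ε ^ 2 := by rw [← h3]; ring
    have e2 : (1 - δ - x - (1 - δ - y)) ^ 2 = 4 * ε ^ 2 := by rw [← h3]; ring
    rw [e1] at hp
    rw [e2] at hq
    have e3 : ε ^ 2 / 2 * (1 / m + 1 / m') = 4 * ε ^ 2 / (8 * m) + 4 * ε ^ 2 / (8 * m') := by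
      field_simp; ring
    rw [e3]
    linarith
  · have : 0 ≤ ε ^ 2 / 2 * (1 / m + 1 / m') := by positivity
    simp [hardMDP, Fin.sum_univ_two, Real.sqrt_mul_self hδ, Real.sqrt_mul_self (sub_nonneg.2 hδ1)]
    simpa using this

/-- An algorithm cannot get the `i`-th sign right on both of two neighbouring instances, as it can
hardly tell them apart. -/
theorem le_expTotal_wrongSign_add (hε : 0 ≤ ε) (hδ : 0 ≤ δ) {m m' : ℝ} (hm : 0 < m)
    (hm' : 0 < m') (hmδ : m ≤ δ - (d - 1 : ℕ) * ε) (hmδ' : m' ≤ 1 - δ - (d - 1 : ℕ) * ε)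
    (hb : ε ^ 2 / 2 * (1 / m + 1 / m') ≤ 1) (σ : Act d) (i : Fin (d - 1)) (T : ℕ) :
    (hardMDP d δ (cubePoint ε σ)).expTotal alg 0 T idle
        - T * √(T * ε ^ 2 * (1 / m + 1 / m'))
      ≤ (hardMDP d δ (cubePoint ε σ)).expTotal alg 0 T (wrongSign σ i) +
        (hardMDP d δ (cubePoint ε (flipSign i σ))).expTotal alg 0 T
          (wrongSign (flipSign i σ) i) := by
  have hΔ0 : 0 ≤ (d - 1 : ℕ) * ε := by positivity
  have hval := fun σ : Act d =>
    hardMDP_isValid hε (by linarith : (d - 1 : ℕ) * ε ≤ δ) (by linarith) σ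
  set b := 1 - ε ^ 2 / 2 * (1 / m + 1 / m') with hbdef
  have hb0 : 0 ≤ b := by linarith
  have hb1 : b ≤ 1 := by
    have : 0 ≤ ε ^ 2 / 2 * (1 / m + 1 / m') := by positivity
    linarith
  have hTV := sum_mul_sub_le_of_affinity
    (P := fun τ : List.Vector (Fin 2 × Act d) T =>
      (hardMDP d δ (cubePoint ε σ)).trajProb alg 0 τ.toList)
    (Q := fun τ : List.Vector (Fin 2 × Act d) T =>
      (hardMDP d δ (cubePoint ε (flipSign i σ))).trajProb alg 0 τ.toList)
    (f := fun τ => (τ.toList.map (wrongSign (flipSign i σ) i)).sum) (B := T)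
    (fun τ => MDP.trajProb_nonneg (hval _) _) (fun τ => MDP.trajProb_nonneg (hval _) _)
    (MDP.sum_trajProb (hval _) T) (MDP.sum_trajProb (hval _) T)
    (fun τ => by
      have hw : ∀ x, wrongSign (flipSign i σ) i x ∈ Set.Icc (0 : ℝ) 1 := fun x => by
        unfold wrongSign; split_ifs <;> simp
      refine ⟨List.sum_nonneg ?_, ?_⟩
      · intro y hy
        obtain ⟨x, -, rfl⟩ := List.mem_map.1 hy
        exact (hw x).1
      · refine (List.sum_le_card_nsmul _ 1 ?_).trans ?_
        · intro y hy
          obtain ⟨x, -, rfl⟩ := List.mem_map.1 hy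
          exact (hw x).2
        · simp)
    (Nat.cast_nonneg T) (pow_nonneg hb0 T)
    (MDP.pow_le_affinity (hval _) (hval _) hb0 hb1
      (le_sum_sqrt_trans_mul hε hδ (by linarith) hm hm' hmδ hmδ' σ i) T)
  have hsqrt : √(1 - (b ^ T) ^ 2) ≤ √(T * ε ^ 2 * (1 / m + 1 / m')) := by
    refine Real.sqrt_le_sqrt ?_
    have := one_add_mul_sub_le_pow (by linarith : -1 ≤ b) (T * 2)
    rw [← pow_mul]
    push_cast at this
    rw [hbdef] at this ⊢
    linarith
  have hmul := mul_le_mul_of_nonneg_left hsqrt (Nat.cast_nonneg (α := ℝ) T)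
  have hP : (hardMDP d δ (cubePoint ε σ)).expTotal alg 0 T (wrongSign (flipSign i σ) i)
      = (hardMDP d δ (cubePoint ε σ)).expTotal alg 0 T idle
        - (hardMDP d δ (cubePoint ε σ)).expTotal alg 0 T (wrongSign σ i) := by
    rw [funext (wrongSign_flipSign σ i), MDP.expTotal_add, MDP.expTotal_const_mul]
    ring
  have hTV' : (hardMDP d δ (cubePoint ε σ)).expTotal alg 0 T (wrongSign (flipSign i σ) i) -
      (hardMDP d δ (cubePoint ε (flipSign i σ))).expTotal alg 0 T (wrongSign (flipSign i σ) i)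
      ≤ T * √(1 - (b ^ T) ^ 2) := hTV
  linarith

/-- Averaging over the cube: if on any two instances that differ in the `i`-th sign the expected
numbers of wrong `i`-th signs add up to at least `K`, then some instance sees at least
`(d - 1) K / 2` wrong signs in all. -/
theorem exists_le_sum_wrongSign {T : ℕ} {K : ℝ}
    (hK : ∀ (σ : Act d) (i : Fin (d - 1)),
      K ≤ (hardMDP d δ (cubePoint ε σ)).expTotal alg 0 T (wrongSign σ i) +
        (hardMDP d δ (cubePoint ε (flipSign i σ))).expTotal alg 0 T
          (wrongSign (flipSign i σ) i)) :
    ∃ σ : Act d, (d - 1 : ℕ) * K / 2 ≤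
      ∑ i, (hardMDP d δ (cubePoint ε σ)).expTotal alg 0 T (wrongSign σ i) := by
  set w : Act d → Fin (d - 1) → ℝ := fun σ i =>
    (hardMDP d δ (cubePoint ε σ)).expTotal alg 0 T (wrongSign σ i) with hw
  have hi : ∀ i, ∑ _σ : Act d, K / 2 ≤ ∑ σ, w σ i := fun i => by
    have hflip : ∑ σ, w (flipSign i σ) i = ∑ σ, w σ i :=
      Equiv.sum_comp (flipSign_involutive i).toPerm fun σ => w σ i
    have h2 : ∑ σ : Act d, K ≤ ∑ σ, (w σ i + w (flipSign i σ) i) :=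
      Finset.sum_le_sum fun σ _ => hK σ i
    rw [Finset.sum_add_distrib, hflip] at h2
    rw [← Finset.sum_div]
    linarith
  obtain ⟨σ, -, hσ⟩ := Finset.exists_le_of_sum_le (s := (Finset.univ : Finset (Act d)))
    Finset.univ_nonempty (f := fun _ => ∑ _i : Fin (d - 1), K / 2) (g := fun σ => ∑ i, w σ i) (by
      rw [Finset.sum_comm, Finset.sum_comm (f := w)]
      exact Finset.sum_le_sum fun i _ => hi i)
  refine ⟨σ, le_of_eq_of_le ?_ hσ⟩
  simp [mul_div_assoc]

end

/-! ### Numerical estimates -/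

theorem gap_sq {d T : ℕ} {δ : ℝ} (hδ : 0 < δ) :
    gap d T δ ^ 2 = ((d : ℝ) - 1) ^ 2 / (2025 * (2 * T * Real.log 2 / (5 * δ))) := by
  have := Real.log_pos one_lt_two
  rw [gap, div_pow, mul_pow, Real.sq_sqrt (by positivity)]
  norm_num

theorem gap_le {d T : ℕ} {δ : ℝ} (hδ : 0 < δ) (hT : 0 < T)
    (h : 16 * ((d : ℝ) - 1) ^ 2 / (2025 * δ) ≤ (T : ℝ)) : gap d T δ ≤ 19 / 40 * δ := by
  have hlog := Real.log_two_gt_d9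
  have hT' : (0 : ℝ) < T := by exact_mod_cast hT
  refine abs_le_of_sq_le_sq' ?_ (by positivity) |>.2
  rw [div_le_iff₀ (by positivity)] at h
  rw [gap_sq hδ, div_le_iff₀ (by positivity)]
  have hd : ((d : ℝ) - 1) ^ 2 ≤ T * (2025 * δ) / 16 := by linarith
  refine hd.trans ?_
  have e : (19 / 40 * δ) ^ 2 * (2025 * (2 * T * Real.log 2 / (5 * δ)))
      = T * (2025 * δ) * ((19 / 40) ^ 2 * 2 / 5 * Real.log 2) := by
    field_simp
  rw [e, div_eq_mul_inv]
  exact mul_le_mul_of_nonneg_left (by norm_num; linarith) (by positivity)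

theorem gap_le_third {d T : ℕ} {δ : ℝ} (hδ : 0 < δ) (hT : 0 < T)
    (h : ((d : ℝ) - 1) ^ 2 / (90 * δ * Real.log 2) ≤ (T : ℝ)) : gap d T δ ≤ δ / 3 := by
  have hlog := Real.log_pos one_lt_two
  have hT' : (0 : ℝ) < T := by exact_mod_cast hT
  refine abs_le_of_sq_le_sq' ?_ (by positivity) |>.2
  rw [div_le_iff₀ (by positivity)] at h
  rw [gap_sq hδ, div_le_iff₀ (by positivity)]
  refine h.trans (le_of_eq ?_)
  field_simp
  norm_num

theorem mul_sq_gap_div {d T : ℕ} {δ : ℝ} (hd : 2 ≤ d) (hδ : 0 < δ) (hT : 0 < T) :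
    T * (gap d T δ / ((d : ℝ) - 1)) ^ 2 = δ / (810 * Real.log 2) := by
  have hlog := Real.log_pos one_lt_two
  have hT' : (0 : ℝ) < T := by exact_mod_cast hT
  have hd' : (0 : ℝ) < (d : ℝ) - 1 := by
    have : (2 : ℝ) ≤ d := by exact_mod_cast hd
    linarith
  rw [div_pow, gap_sq hδ]
  field_simp
  norm_num

/-! ### The lower bound -/

/-- The minimax lower bound with its dependence on the dimension; both bounds of the theorem are
consequences, as the span of the bias is at most `1 / (2 δ)`. -/
theorem exists_regret_ge {d T : ℕ} {δ : ℝ} (hd : 2 ≤ d) (hδ : 0 < δ) (hδ1 : δ ≤ 2 / 3)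
    (hT : 0 < T) (h : 16 * ((d : ℝ) - 1) ^ 2 / (2025 * δ) ≤ (T : ℝ))
    (alg : Algorithm (Fin 2) (Act d)) :
    ∃ σ : Act d, ∀ J v q,
      (hardMDP d δ (cubePoint (gap d T δ / ((d : ℝ) - 1)) σ)).BellmanOptimal J v q →
        ((d : ℝ) - 1) / 2025 * √(T / δ) ≤
          (hardMDP d δ (cubePoint (gap d T δ / ((d : ℝ) - 1)) σ)).expRegret J alg 0 T := by
  have hd' : (0 : ℝ) < (d : ℝ) - 1 := by
    have : (2 : ℝ) ≤ d := by exact_mod_cast hd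
    linarith
  have hT' : (0 : ℝ) < T := by exact_mod_cast hT
  have hg := gap_pos hd hδ hT
  have hgle := gap_le hδ hT h
  have hεsq := mul_sq_gap_div hd hδ hT
  set ε := gap d T δ / ((d : ℝ) - 1) with hεdef
  have hε : 0 < ε := div_pos hg hd'
  have hΔ : (d - 1 : ℕ) * ε = gap d T δ := by
    rw [cast_pred hd, hεdef]; field_simp
  have hlog1 := Real.log_two_gt_d9
  have hlog2 := Real.log_two_lt_d9
  have hup : T * ε ^ 2 ≤ δ / 561 := by
    rw [hεsq]
    exact div_le_div_of_nonneg_left hδ.le (by norm_num) (by linarith)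
  have hlow : δ / 625 ≤ T * ε ^ 2 := by
    rw [hεsq]
    exact div_le_div_of_nonneg_left hδ.le (by linarith) (by linarith)
  -- since `Δ ≤ 19 δ / 40` and `δ ≤ 2 / 3`, all transition probabilities out of `x₀` are at least
  -- `21 δ / 40` respectively `1 / 60`
  have hm : 0 < 21 / 40 * δ := by positivity
  have hinv : T * ε ^ 2 * (1 / (21 / 40 * δ) + 1 / (1 / 60)) ≤ (7 / 25) ^ 2 := by
    calc T * ε ^ 2 * (1 / (21 / 40 * δ) + 1 / (1 / 60))
        ≤ δ / 561 * (1 / (21 / 40 * δ) + 1 / (1 / 60)) :=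
          mul_le_mul_of_nonneg_right hup (by positivity)
      _ = (40 / 21 + 60 * δ) / 561 := by field_simp
      _ ≤ (7 / 25) ^ 2 := by linarith
  have hb : ε ^ 2 / 2 * (1 / (21 / 40 * δ) + 1 / (1 / 60)) ≤ 1 := by
    have h1T : (1 : ℝ) ≤ T := by exact_mod_cast hT
    have : ε ^ 2 * (1 / (21 / 40 * δ) + 1 / (1 / 60))
        ≤ T * (ε ^ 2 * (1 / (21 / 40 * δ) + 1 / (1 / 60))) :=
      le_mul_of_one_le_left (by positivity) h1T
    linarith
  have hsqrt : √(T * ε ^ 2 * (1 / (21 / 40 * δ) + 1 / (1 / 60))) ≤ 7 / 25 :=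
    Real.sqrt_le_iff.2 ⟨by norm_num, hinv⟩
  have hK : ∀ (σ : Act d) (i : Fin (d - 1)), 3 / 25 * (T : ℝ) ≤
      (hardMDP d δ (cubePoint ε σ)).expTotal alg 0 T (wrongSign σ i) +
        (hardMDP d δ (cubePoint ε (flipSign i σ))).expTotal alg 0 T
          (wrongSign (flipSign i σ) i) := fun σ i => by
    have h1 := le_expTotal_wrongSign_add (alg := alg) hε.le hδ.le hm (by norm_num : (0 : ℝ) < 1 / 60)
      (by linarith) (by linarith) hb σ i T
    have h2 := le_expTotal_idle (δ := δ) (alg := alg) hε.le (by linarith) (by linarith) σ T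
    have h3 : 40 / 99 * (T : ℝ) ≤ (hardMDP d δ (cubePoint ε σ)).expTotal alg 0 T idle := by
      have hpos : 0 < 2 * δ + gap d T δ := by positivity
      rw [hΔ] at h2
      have h4 : (2 * δ + gap d T δ) * (40 / 99 * T) ≤ T * δ := by nlinarith
      exact le_of_mul_le_mul_left (h4.trans h2) hpos
    have h5 := mul_le_mul_of_nonneg_left hsqrt hT'.le
    linarith
  obtain ⟨σ, hσ⟩ := exists_le_sum_wrongSign hK
  refine ⟨σ, fun J v q hB => ?_⟩
  have hJ := (hardMDP_bellmanOptimal_unique hε.le hδ (by linarith) σ hB).1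
  have hreg := sum_wrongSign_le_expRegret (alg := alg) hε.le hδ (by linarith) (by linarith) σ T
  rw [hJ]
  refine le_trans ?_ hreg
  rw [hΔ, cast_pred hd] at *
  have hsqrtT : √(T / δ) ≤ 25 * (ε * T / δ) := by
    refine Real.sqrt_le_iff.2 ⟨by positivity, ?_⟩
    have e : (25 * (ε * T / δ)) ^ 2 = 625 * (T * ε ^ 2) / δ * (T / δ) := by
      field_simp; norm_num
    rw [e]
    refine le_mul_of_one_le_left (by positivity) ?_
    rw [one_le_div hδ]
    linarith
  have hcoef : 80 / 99 * (ε / δ) ≤ 2 * ε / (2 * δ + gap d T δ) := by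
    rw [le_div_iff₀ (by positivity)]
    calc 80 / 99 * (ε / δ) * (2 * δ + gap d T δ)
        ≤ 80 / 99 * (ε / δ) * (99 / 40 * δ) :=
          mul_le_mul_of_nonneg_left (by linarith) (by positivity)
      _ = 2 * ε := by field_simp; norm_num
  have hnn : 0 ≤ ((d : ℝ) - 1) * (ε * T / δ) := by positivity
  calc ((d : ℝ) - 1) / 2025 * √(T / δ) ≤ ((d : ℝ) - 1) / 2025 * (25 * (ε * T / δ)) :=
        mul_le_mul_of_nonneg_left hsqrtT (by positivity)
    _ = 25 / 2025 * (((d : ℝ) - 1) * (ε * T / δ)) := by ring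
    _ ≤ 80 / 99 * (3 / 50) * (((d : ℝ) - 1) * (ε * T / δ)) :=
        mul_le_mul_of_nonneg_right (by norm_num) hnn
    _ = 80 / 99 * (ε / δ) * (((d : ℝ) - 1) * (3 / 25 * T) / 2) := by field_simp; norm_num
    _ ≤ _ := mul_le_mul hcoef hσ (by positivity) (by positivity)

end AvgRewardMDP

open AvgRewardMDP in
theorem theorem2 :
    ∃ c : ℝ, 0 < c ∧ ∀ (d T : ℕ) (δ : ℝ), 2 ≤ d → 0 < δ → δ ≤ 2 / 3 →
      16 * ((d : ℝ) - 1) ^ 2 / (2025 * δ) ≤ (T : ℝ) →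
      -- the instance is a linear mixture MDP, with the stated size of the parameter and span
      (∀ θ ∈ hypercube d T δ,
        (hardMDP d δ θ).IsValid ∧
        (hardMDP d δ θ).IsLinearMixture (hardFeature d T δ) (thetaBar d T δ θ) ∧
        ‖thetaBar d T δ θ‖ ≤ 1 + δ / 2 ∧
        (((d : ℝ) - 1) ^ 2 / (90 * δ * Real.log 2) ≤ (T : ℝ) →
          ‖thetaBar d T δ θ‖ ≤ 1 + δ / 3) ∧
        (∃ J v q, (hardMDP d δ θ).BellmanOptimal J v q) ∧
        ∀ J v q, (hardMDP d δ θ).BellmanOptimal J v q →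
          1 / (3 * δ) ≤ span v ∧ span v ≤ 1 / (2 * δ)) ∧
      -- the size of the features
      (∀ (L : ℝ) (F : Fin 2 → ℝ), (∀ s, F s ∈ Set.Icc 0 L) →
        ∀ (s : Fin 2) (a : Act d), ‖aggFeature (hardFeature d T δ) F s a‖ ≤ L) ∧
      -- the lower bound on the regret
      ∀ alg : Algorithm (Fin 2) (Act d), ∃ θ ∈ hypercube d T δ,
        ∀ J v q, (hardMDP d δ θ).BellmanOptimal J v q →
          1 / 2025 * Real.sqrt (T / δ) ≤ (hardMDP d δ θ).expRegret J alg 0 T ∧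
          c * d * Real.sqrt (span v * T) ≤ (hardMDP d δ θ).expRegret J alg 0 T := by
  refine ⟨1 / 4050, by norm_num, fun d T δ hd hδ hδ1 hT => ?_⟩
  have hd' : (2 : ℝ) ≤ d := by exact_mod_cast hd
  have hT' : (0 : ℝ) < T := lt_of_lt_of_le (by have : (0 : ℝ) < d - 1 := by linarith
                                               positivity) hT
  have hT0 : 0 < T := by exact_mod_cast hT'
  have hg := gap_pos hd hδ hT0
  have hgle := gap_le hδ hT0 hT
  have hε : 0 < gap d T δ / ((d : ℝ) - 1) := div_pos hg (by linarith)
  have hΔ : (d - 1 : ℕ) * (gap d T δ / ((d : ℝ) - 1)) = gap d T δ := by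
    rw [cast_pred hd, mul_div_cancel₀ _ (by linarith : (d : ℝ) - 1 ≠ 0)]
  have hspan : ∀ (σ : Act d) (J : ℝ) (v : Fin 2 → ℝ) (q : Fin 2 → Act d → ℝ),
      (hardMDP d δ (cubePoint (gap d T δ / ((d : ℝ) - 1)) σ)).BellmanOptimal J v q →
        1 / (3 * δ) ≤ AvgRewardMDP.span v ∧ AvgRewardMDP.span v ≤ 1 / (2 * δ) := by
    intro σ J v q hB
    rw [(hardMDP_bellmanOptimal_unique hε.le hδ (by linarith) σ hB).2, hΔ]
    exact ⟨one_div_le_one_div_of_le (by positivity) (by linarith),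
      one_div_le_one_div_of_le (by positivity) (by linarith)⟩
  refine ⟨fun θ hθ => ?_, fun L F hF s a => norm_aggFeature_le hd hg hδ.le (by linarith) hF s a,
    fun alg => ?_⟩
  · have hnorm := norm_thetaBar hd hg hθ
    refine ⟨?_, hardMDP_isLinearMixture hd hg θ, by linarith, fun hT2 => ?_, ?_⟩
    · obtain ⟨σ, rfl⟩ := exists_eq_cubePoint hθ
      exact hardMDP_isValid hε.le (by linarith) (by linarith) σ
    · have := gap_le_third hδ hT0 hT2
      linarith
    · obtain ⟨σ, rfl⟩ := exists_eq_cubePoint hθ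
      exact ⟨hardMDP_exists_bellmanOptimal hε.le hδ σ, hspan σ⟩
  · obtain ⟨σ, hσ⟩ := exists_regret_ge hd hδ hδ1 hT0 hT alg
    refine ⟨_, cubePoint_mem_hypercube σ, fun J v q hB => ⟨?_, ?_⟩⟩
    · refine le_trans (mul_le_mul_of_nonneg_right ?_ (Real.sqrt_nonneg _)) (hσ J v q hB)
      exact div_le_div_of_nonneg_right (by linarith) (by norm_num)
    · refine le_trans ?_ (hσ J v q hB)
      have hle : √(AvgRewardMDP.span v * T) ≤ √(T / δ) := by
        refine Real.sqrt_le_sqrt ?_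
        rw [div_eq_mul_one_div, mul_comm]
        refine mul_le_mul_of_nonneg_left ((hspan σ J v q hB).2.trans ?_) hT'.le
        exact one_div_le_one_div_of_le hδ (by linarith)
      -- `d ≤ 2 (d - 1)`, which explains the constant `1 / 4050`
      exact mul_le_mul (by linarith) hle (Real.sqrt_nonneg _) (by linarith)
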